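/- For $n\in\mathbb N=\{1,2,\dots\}$ let $f_n:[0,1]\to[0,1]$ be $C^1$ maps (with one-sided derivatives at the endpoints) such that: (1) there exist $m\in\mathbb N$ and $0<A<1$ such that $0<|(f_{a_1}\circ\cdots\circ f_{a_m})'(x)|\le A$ for all $(a_1,\dots,a_m)\in\mathbb N^m$ and all $x\in[0,1]$; (2) $f_i((0,1))\cap f_j((0,1))=\emptyset$ for all $i\neq j$; (3) $d>1$ is such that for every $\varepsilon>0$ there exist $C_1,C_2>0$ such that for each $i\in\mathbb N$ there are constants $\xi_i,\lambda_i$ with $\xi_i\le|f_i'(x)|\le\lambda_i$ for all $x\in[0,1]$ and $$\frac{C_1}{i^{d+\varepsilon}}\le\xi_i\le\lambda_i\le\frac{C_2}{i^{d-\varepsilon}}.$$ For a sequence $\underline a=(a_n)_{n\ge1}$ of positive integers let $\Pi(\underline a)=\lim_{n\to\infty}f_{a_1}\circ\cdots\circ f_{a_n}(1)$; the limit exists by (1). Let $\Phi:\mathbb N\to\mathbb R$ be such that for some $\beta\ge1$ we have $n\le\Phi(n)\le\beta n$ for all $n\in\mathbb N$, and let $$X_\Phi=\{\Pi(\underline a):\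 a_{n+1}>\Phi(a_n)\text{ for all }n\in\mathbb N\}.$$ Then the Hausdorff dimension of $X_\Phi$ is exactly $\dim_H X_\Phi=\frac1d$. -/

import Mathlib

open Set Filter Topology

/-- The composition `f i₁ ∘ f i₂ ∘ ⋯ ∘ f iₙ` along a finite word `i₁ i₂ … iₙ` of positive
integers (the identity for the empty word). -/
def wordMap (f : ℕ+ → ℝ → ℝ) : List ℕ+ → ℝ → ℝ
  | [] => id
  | i :: w => f i ∘ wordMap f w

/-- `f i`, `i = 1, 2, …`, is a `d`-decaying iterated function system of `C¹` maps on `[0,1]`.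
Derivatives on `[0,1]` are one-sided at the endpoints, whence `derivWithin`. -/
structure IsDecayingIFS (f : ℕ+ → ℝ → ℝ) (d : ℝ) : Prop where
  mapsTo : ∀ i, MapsTo (f i) (Icc 0 1) (Icc 0 1)
  contDiffOn : ∀ i, ContDiffOn ℝ 1 (f i) (Icc 0 1)
  contracting : ∃ m : ℕ, 0 < m ∧ ∃ A : ℝ, 0 < A ∧ A < 1 ∧
    ∀ a : Fin m → ℕ+, ∀ x ∈ Icc (0 : ℝ) 1,
      0 < |derivWithin (wordMap f (List.ofFn a)) (Icc 0 1) x| ∧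
        |derivWithin (wordMap f (List.ofFn a)) (Icc 0 1) x| ≤ A
  disjoint : ∀ i j, i ≠ j → f i '' Ioo 0 1 ∩ f j '' Ioo 0 1 = ∅
  one_lt : 1 < d
  decay : ∀ ε : ℝ, 0 < ε → ∃ C₁ C₂ : ℝ, 0 < C₁ ∧ 0 < C₂ ∧ ∀ i : ℕ+, ∃ ξ lam : ℝ,
    (∀ x ∈ Icc (0 : ℝ) 1,
      ξ ≤ |derivWithin (f i) (Icc 0 1) x| ∧ |derivWithin (f i) (Icc 0 1) x| ≤ lam) ∧
    C₁ / ((i : ℕ) : ℝ) ^ (d + ε) ≤ ξ ∧ ξ ≤ lam ∧ lam ≤ C₂ / ((i : ℕ) : ℝ) ^ (d - ε)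

/-- `x` has the digit sequence `a`: it is the limit of `f (a 0) ∘ ⋯ ∘ f (a (n-1))` at `1`.
(Sequences are indexed from `0`, digits are positive integers.) A point may have several
digit sequences. -/
def HasDigits (f : ℕ+ → ℝ → ℝ) (a : ℕ → ℕ+) (x : ℝ) : Prop :=
  Tendsto (fun n : ℕ => wordMap f (List.ofFn fun k : Fin n => a k) 1) atTop (𝓝 x)

/-- The set of points having a digit sequence with `a (n+1) > Φ (a n)` for all `n`. -/
def growingDigitSet (f : ℕ+ → ℝ → ℝ) (Φ : ℕ+ → ℝ) : Set ℝ :=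
  {x | ∃ a : ℕ → ℕ+, (∀ n, Φ (a n) < ((a (n + 1) : ℕ) : ℝ)) ∧ HasDigits f a x}

/-!
Only increasing digit sequences matter, and the derivative of `f i` lies between `i ^ (-(d + ε))`
and `i ^ (-(d - ε))` up to constants, so the cylinder `f a₁ ∘ ⋯ ∘ f aₙ ([0,1])` has length between
the corresponding products (`abs_wordMap_sub_le`, `le_abs_wordMap_sub`). No bounded distortion is
needed, because the losses of `ε` in the exponent are harmless.

*Upper bound.* Let `p > 1 / d`. Then the `p`-th powers of the Lipschitz constants of the `f i` are
summable, so outside some finite set `F` of digits their sum `σ` is less than `1`. An injective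
digit sequence leaves `F` eventually. The points whose digits after a fixed initial word all avoid
`F` are covered by the cylinders of level `n` over that word, and the sum of the `p`-th powers of
their diameters is at most a constant times `σ ^ n`, by expanding the power
(`dimH_injective_digits_le`). There are countably many initial words.

*Lower bound.* Let `s < 1 / d` and let the `k`-th digit (`k = 0, 1, …`) range over
`(M ^ (k+1), 2 * M ^ (k+1)]` for a large `M`; then the growth condition holds. The uniform measure
on these digit sequences gives a cylinder of level `n` the mass `∏ M ^ (-(k+1))`, while its length
is at least `δ n = ∏ c / (2 * M ^ (k+1)) ^ D` with `D > d` and `D * s < 1`. The open cylinders of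
one level are disjoint, so a set of diameter at most `δ n` meets at most three closed ones
(`measure_preimage_le`). Both logarithms are quadratic in `n`, so passing from level `n` to level
`n + 1` costs only a lower order term and the mass of level `n` is eventually below
`δ (n + 1) ^ s` (`eventually_mass_le`). The mass distribution principle finishes the proof
(`le_dimH_range`).
-/

/-! ### Bi-Lipschitz bounds for words -/

theorem IsDecayingIFS.exists_upper {f : ℕ+ → ℝ → ℝ} {d : ℝ} (hf : IsDecayingIFS f d) {ε : ℝ}
    (hε : 0 < ε) : ∃ C : ℝ, 0 < C ∧ ∀ i : ℕ+, ∀ x ∈ Icc (0 : ℝ) 1, ∀ y ∈ Icc (0 : ℝ) 1,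
      |f i x - f i y| ≤ C / ((i : ℕ) : ℝ) ^ (d - ε) * |x - y| := by
  obtain ⟨C₁, C₂, h₁, h₂, h⟩ := hf.decay ε hε
  refine ⟨C₂, h₂, fun i x hx y hy => ?_⟩
  obtain ⟨ξ, lam, hb, -, -, hlam⟩ := h i
  have := (convex_Icc (0 : ℝ) 1).norm_image_sub_le_of_norm_derivWithin_le (f := f i)
    ((hf.contDiffOn i).differentiableOn one_ne_zero)
    (fun z hz => ((hb z hz).2.trans hlam)) hy hx
  simpa using this

theorem IsDecayingIFS.exists_lower {f : ℕ+ → ℝ → ℝ} {d : ℝ} (hf : IsDecayingIFS f d) {ε : ℝ}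
    (hε : 0 < ε) : ∃ C : ℝ, 0 < C ∧ ∀ i : ℕ+, ∀ x ∈ Icc (0 : ℝ) 1, ∀ y ∈ Icc (0 : ℝ) 1,
      C / ((i : ℕ) : ℝ) ^ (d + ε) * |x - y| ≤ |f i x - f i y| := by
  obtain ⟨C₁, C₂, h₁, h₂, h⟩ := hf.decay ε hε
  refine ⟨C₁, h₁, fun i x hx y hy => ?_⟩
  obtain ⟨ξ, lam, hb, hξ, -, -⟩ := h i
  have key : ∀ x ∈ Icc (0 : ℝ) 1, ∀ y ∈ Icc (0 : ℝ) 1, x < y →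
      C₁ / ((i : ℕ) : ℝ) ^ (d + ε) * |x - y| ≤ |f i x - f i y| := by
    intro x hx y hy hxy
    have hsub : Icc x y ⊆ Icc (0 : ℝ) 1 := Icc_subset_Icc hx.1 hy.2
    have hd := (hf.contDiffOn i).differentiableOn one_ne_zero
    have hn : ∀ z ∈ Ioo x y, Icc (0 : ℝ) 1 ∈ 𝓝 z := fun z hz =>
      Icc_mem_nhds (hx.1.trans_lt hz.1) (hz.2.trans_le hy.2)
    obtain ⟨c, hc, hslope⟩ := exists_deriv_eq_slope (f i) hxy (hd.continuousOn.mono hsub)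
      (fun z hz => ((hd z (hsub (Ioo_subset_Icc_self hz))).differentiableAt
        (hn z hz)).differentiableWithinAt)
    have hbc := (hb c (hsub (Ioo_subset_Icc_self hc))).1
    rw [derivWithin_of_mem_nhds (hn c hc), hslope, abs_div] at hbc
    have hpos : 0 < |y - x| := abs_pos.2 (sub_ne_zero.2 hxy.ne')
    rw [abs_sub_comm x y, abs_sub_comm (f i x)]
    exact (le_div_iff₀ hpos).1 (hξ.trans hbc)
  rcases lt_trichotomy x y with hxy | rfl | hxy
  · exact key x hx y hy hxy
  · simp
  · rw [abs_sub_comm x y, abs_sub_comm (f i x)]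
    exact key y hy x hx hxy

section Words

variable {f : ℕ+ → ℝ → ℝ}

theorem wordMap_append (u v : List ℕ+) : wordMap f (u ++ v) = wordMap f u ∘ wordMap f v := by
  induction u with
  | nil => rfl
  | cons i u ih => simp only [List.cons_append, wordMap, ih, Function.comp_assoc]

theorem wordMap_mapsTo (hm : ∀ i, MapsTo (f i) (Icc 0 1) (Icc 0 1)) (w : List ℕ+) :
    MapsTo (wordMap f w) (Icc 0 1) (Icc 0 1) := by
  induction w with
  | nil => exact mapsTo_id _
  | cons i w ih => exact (hm i).comp ih

theorem wordMap_continuousOn (hm : ∀ i, MapsTo (f i) (Icc 0 1) (Icc 0 1))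
    (hc : ∀ i, ContinuousOn (f i) (Icc 0 1)) (w : List ℕ+) :
    ContinuousOn (wordMap f w) (Icc 0 1) := by
  induction w with
  | nil => exact continuousOn_id
  | cons i w ih => exact (hc i).comp ih (wordMap_mapsTo hm w)

theorem wordMap_injOn (hm : ∀ i, MapsTo (f i) (Icc 0 1) (Icc 0 1))
    (hi : ∀ i, InjOn (f i) (Icc 0 1)) (w : List ℕ+) : InjOn (wordMap f w) (Icc 0 1) := by
  induction w with
  | nil => exact injOn_id _
  | cons i w ih => exact (hi i).comp ih (wordMap_mapsTo hm w)

theorem abs_wordMap_sub_le (hm : ∀ i, MapsTo (f i) (Icc 0 1) (Icc 0 1)) {U : ℕ+ → ℝ}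
    (hU0 : ∀ i, 0 ≤ U i) (hU : ∀ i : ℕ+, ∀ x ∈ Icc (0 : ℝ) 1, ∀ y ∈ Icc (0 : ℝ) 1,
      |f i x - f i y| ≤ U i * |x - y|) (w : List ℕ+) {x y : ℝ} (hx : x ∈ Icc (0 : ℝ) 1)
    (hy : y ∈ Icc (0 : ℝ) 1) :
    |wordMap f w x - wordMap f w y| ≤ (w.map U).prod * |x - y| := by
  induction w with
  | nil => simp [wordMap]
  | cons i w ih =>
    rw [List.map_cons, List.prod_cons, mul_assoc]
    exact (hU i _ (wordMap_mapsTo hm w hx) _ (wordMap_mapsTo hm w hy)).trans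
      (mul_le_mul_of_nonneg_left ih (hU0 i))

theorem le_abs_wordMap_sub (hm : ∀ i, MapsTo (f i) (Icc 0 1) (Icc 0 1)) {L : ℕ+ → ℝ}
    (hL0 : ∀ i, 0 ≤ L i) (hL : ∀ i : ℕ+, ∀ x ∈ Icc (0 : ℝ) 1, ∀ y ∈ Icc (0 : ℝ) 1,
      L i * |x - y| ≤ |f i x - f i y|) (w : List ℕ+) {x y : ℝ} (hx : x ∈ Icc (0 : ℝ) 1)
    (hy : y ∈ Icc (0 : ℝ) 1) :
    (w.map L).prod * |x - y| ≤ |wordMap f w x - wordMap f w y| := by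
  induction w with
  | nil => simp [wordMap]
  | cons i w ih =>
    rw [List.map_cons, List.prod_cons, mul_assoc]
    exact (mul_le_mul_of_nonneg_left ih (hL0 i)).trans
      (hL i _ (wordMap_mapsTo hm w hx) _ (wordMap_mapsTo hm w hy))

/-- A continuous injective function on `[0,1]` maps `[0,1]` into the interval spanned by
the images of the endpoints, and maps `(0,1)` onto its interior. -/
theorem image_unitInterval {g : ℝ → ℝ} (hc : ContinuousOn g (Icc 0 1))
    (hi : InjOn g (Icc 0 1)) :
    MapsTo g (Icc 0 1) (Icc (min (g 0) (g 1)) (max (g 0) (g 1))) ∧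
      g '' Ioo 0 1 = Ioo (min (g 0) (g 1)) (max (g 0) (g 1)) := by
  have h0 : (0 : ℝ) ∈ Icc (0 : ℝ) 1 := by simp
  have h1 : (1 : ℝ) ∈ Icc (0 : ℝ) 1 := by simp
  rcases hc.strictMonoOn_of_injOn_Icc' zero_le_one hi with h | h
  · have hlt := h h0 h1 zero_lt_one
    rw [min_eq_left hlt.le, max_eq_right hlt.le]
    refine ⟨fun x hx => ⟨h.monotoneOn h0 hx hx.1, h.monotoneOn hx h1 hx.2⟩, ?_⟩
    refine Subset.antisymm ?_ (intermediate_value_Ioo zero_le_one hc)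
    rintro _ ⟨x, hx, rfl⟩
    exact ⟨h h0 (Ioo_subset_Icc_self hx) hx.1, h (Ioo_subset_Icc_self hx) h1 hx.2⟩
  · have hlt := h h0 h1 zero_lt_one
    rw [min_eq_right hlt.le, max_eq_left hlt.le]
    refine ⟨fun x hx => ⟨h.antitoneOn hx h1 hx.2, h.antitoneOn h0 hx hx.1⟩, ?_⟩
    refine Subset.antisymm ?_ (intermediate_value_Ioo' zero_le_one hc)
    rintro _ ⟨x, hx, rfl⟩
    exact ⟨h (Ioo_subset_Icc_self hx) h1 hx.2, h h0 (Ioo_subset_Icc_self hx) hx.1⟩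

theorem mapsTo_Ioo_of_injOn {g : ℝ → ℝ} (hm : MapsTo g (Icc 0 1) (Icc 0 1))
    (hc : ContinuousOn g (Icc 0 1)) (hi : InjOn g (Icc 0 1)) : MapsTo g (Ioo 0 1) (Ioo 0 1) := by
  intro x hx
  have h := (image_unitInterval hc hi).2.subset (mem_image_of_mem g hx)
  have h0 := hm (show (0 : ℝ) ∈ Icc (0 : ℝ) 1 by simp)
  have h1 := hm (show (1 : ℝ) ∈ Icc (0 : ℝ) 1 by simp)
  exact ⟨(le_min h0.1 h1.1).trans_lt h.1, h.2.trans_le (max_le h0.2 h1.2)⟩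

theorem wordMap_mapsTo_Ioo (hm : ∀ i, MapsTo (f i) (Icc 0 1) (Icc 0 1))
    (hc : ∀ i, ContinuousOn (f i) (Icc 0 1)) (hi : ∀ i, InjOn (f i) (Icc 0 1)) (w : List ℕ+) :
    MapsTo (wordMap f w) (Ioo 0 1) (Ioo 0 1) :=
  mapsTo_Ioo_of_injOn (wordMap_mapsTo hm w) (wordMap_continuousOn hm hc w)
    (wordMap_injOn hm hi w)

/-- Open cylinders of distinct words of the same length are disjoint. -/
theorem eq_of_wordMap_eq (hm : ∀ i, MapsTo (f i) (Icc 0 1) (Icc 0 1))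
    (hc : ∀ i, ContinuousOn (f i) (Icc 0 1)) (hi : ∀ i, InjOn (f i) (Icc 0 1))
    (hd : ∀ i j, i ≠ j → f i '' Ioo 0 1 ∩ f j '' Ioo 0 1 = ∅) :
    ∀ {v w : List ℕ+}, v.length = w.length → ∀ {x y : ℝ}, x ∈ Ioo (0 : ℝ) 1 →
      y ∈ Ioo (0 : ℝ) 1 → wordMap f v x = wordMap f w y → v = w
  | [], [], _, _, _, _, _, _ => rfl
  | i :: v, j :: w, hlen, x, y, hx, hy, h => by
    have hx' := wordMap_mapsTo_Ioo hm hc hi v hx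
    have hy' := wordMap_mapsTo_Ioo hm hc hi w hy
    have hij : i = j := by
      by_contra hne
      have : f i (wordMap f v x) ∈ f i '' Ioo 0 1 ∩ f j '' Ioo 0 1 :=
        ⟨mem_image_of_mem _ hx', wordMap f w y, hy', h.symm⟩
      simp [hd i j hne] at this
    subst hij
    have := hi i (Ioo_subset_Icc_self hx') (Ioo_subset_Icc_self hy') h
    rw [eq_of_wordMap_eq hm hc hi hd (by simpa using hlen) hx hy this]

theorem ofFn_add_eq_append (a : ℕ → ℕ+) (m n : ℕ) :
    (List.ofFn fun k : Fin (m + n) => a k) =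
      (List.ofFn fun k : Fin m => a k) ++ List.ofFn fun k : Fin n => a (m + k) := by
  rw [List.ofFn_add]
  simp

/-- A point with digits `a` lies in the closed cylinder of every prefix of `a`. -/
theorem HasDigits.mem_image (hm : ∀ i, MapsTo (f i) (Icc 0 1) (Icc 0 1))
    (hc : ∀ i, ContinuousOn (f i) (Icc 0 1)) {a : ℕ → ℕ+} {x : ℝ} (h : HasDigits f a x) (n : ℕ) :
    x ∈ wordMap f (List.ofFn fun k : Fin n => a k) '' Icc 0 1 := by
  have hcl : IsClosed (wordMap f (List.ofFn fun k : Fin n => a k) '' Icc 0 1) :=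
    (isCompact_Icc.image_of_continuousOn (wordMap_continuousOn hm hc _)).isClosed
  refine hcl.mem_of_tendsto h ?_
  filter_upwards [eventually_ge_atTop n] with m hmn
  obtain ⟨j, rfl⟩ := Nat.exists_eq_add_of_le hmn
  rw [ofFn_add_eq_append, wordMap_append]
  exact mem_image_of_mem _ (wordMap_mapsTo hm _ (by simp))

end Words

/-! ### Upper bound: small tails of the digit alphabet -/

open scoped ENNReal NNReal

theorem ENNReal.tsum_pi_prod {ι : Type*} (g : ι → ℝ≥0∞) (n : ℕ) :
    ∑' w : Fin n → ι, ∏ k, g (w k) = (∑' i, g i) ^ n := by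
  induction n with
  | zero => simp
  | succ n ih =>
    rw [← (Fin.consEquiv fun _ : Fin (n + 1) => ι).tsum_eq, ENNReal.tsum_prod', pow_succ', ← ih,
      ← ENNReal.tsum_mul_right]
    refine tsum_congr fun i => ?_
    rw [← ENNReal.tsum_mul_left]
    refine tsum_congr fun w => ?_
    simp [Fin.prod_univ_succ, Fin.consEquiv]

/-- If the coverings of `s` by the countable families `t n` satisfy `∑ diam ^ p → 0`, then `s`
has dimension at most `p`. -/
theorem dimH_le_of_tendsto_tsum_zero {X : Type*} [EMetricSpace X] {s : Set X} {p : ℝ≥0}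
    (hp : 0 < p) {ι : ℕ → Type*} [∀ n, Countable (ι n)] (t : ∀ n, ι n → Set X)
    (hst : ∀ n, s ⊆ ⋃ i, t n i)
    (h : Tendsto (fun n => ∑' i, Metric.ediam (t n i) ^ (p : ℝ)) atTop (𝓝 0)) : dimH s ≤ p := by
  borelize X
  have hp' : (0 : ℝ) < p := hp
  refine dimH_le_of_hausdorffMeasure_ne_top (ne_top_of_le_ne_top ENNReal.zero_ne_top ?_)
  refine (MeasureTheory.Measure.hausdorffMeasure_le_liminf_tsum (p : ℝ) s
    (fun n => (∑' i, Metric.ediam (t n i) ^ (p : ℝ)) ^ (1 / (p : ℝ))) ?_ t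
    (Eventually.of_forall fun n i => ?_) (Eventually.of_forall hst)).trans h.liminf_eq.le
  · have := (ENNReal.continuous_rpow_const (y := 1 / (p : ℝ))).tendsto 0 |>.comp h
    rwa [ENNReal.zero_rpow_of_pos (by positivity)] at this
  · calc Metric.ediam (t n i) = (Metric.ediam (t n i) ^ (p : ℝ)) ^ (1 / (p : ℝ)) := by
          rw [← ENNReal.rpow_mul, mul_one_div_cancel hp'.ne', ENNReal.rpow_one]
      _ ≤ _ := ENNReal.rpow_le_rpow
          (ENNReal.le_tsum (f := fun i => Metric.ediam (t n i) ^ (p : ℝ)) i) (by positivity)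

/-- If the `p`-th powers of the Lipschitz constants of the maps are summable, then the points with
an injective digit sequence form a set of dimension at most `p`: apart from finitely many initial
digits, only digits from a tail of small total weight occur. -/
theorem dimH_injective_digits_le {f : ℕ+ → ℝ → ℝ} (hm : ∀ i, MapsTo (f i) (Icc 0 1) (Icc 0 1))
    (hc : ∀ i, ContinuousOn (f i) (Icc 0 1)) {U : ℕ+ → ℝ} (hU0 : ∀ i, 0 ≤ U i)
    (hU : ∀ i : ℕ+, ∀ x ∈ Icc (0 : ℝ) 1, ∀ y ∈ Icc (0 : ℝ) 1,
      |f i x - f i y| ≤ U i * |x - y|) {p : ℝ≥0} (hp : 0 < p)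
    (hsum : ∑' i, ENNReal.ofReal (U i) ^ (p : ℝ) ≠ ∞) :
    dimH {x | ∃ a : ℕ → ℕ+, a.Injective ∧ HasDigits f a x} ≤ p := by
  have hp' : (0 : ℝ) < p := hp
  set g : ℕ+ → ℝ≥0∞ := fun i => ENNReal.ofReal (U i) ^ (p : ℝ) with hg
  obtain ⟨F, hF⟩ := ((ENNReal.tendsto_tsum_compl_atTop_zero hsum).eventually_lt_const
    (show (0 : ℝ≥0∞) < 1 by simp)).exists
  let T : List ℕ+ → ∀ n, (Fin n → {i // i ∉ F}) → Set ℝ := fun u n w =>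
    wordMap f (u ++ List.ofFn fun k => (w k : ℕ+)) '' Icc 0 1
  have hcover : {x | ∃ a : ℕ → ℕ+, a.Injective ∧ HasDigits f a x} ⊆
      ⋃ u : List ℕ+, ⋂ n, ⋃ w, T u n w := by
    rintro x ⟨a, ha, hx⟩
    have hev : ∀ᶠ n in atTop, a n ∉ F := by
      have := ha.tendsto_cofinite.eventually (F.finite_toSet.compl_mem_cofinite)
      rw [Nat.cofinite_eq_atTop] at this
      simpa using this
    obtain ⟨N, hN⟩ := eventually_atTop.1 hev
    refine mem_iUnion.2 ⟨List.ofFn fun k : Fin N => a k, mem_iInter.2 fun n => mem_iUnion.2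
      ⟨fun k => ⟨a (N + k), hN _ (by omega)⟩, ?_⟩⟩
    have := hx.mem_image hm hc (N + n)
    rwa [ofFn_add_eq_append] at this
  refine (dimH_mono hcover).trans ?_
  rw [dimH_iUnion]
  refine iSup_le fun u => dimH_le_of_tendsto_tsum_zero hp (T u)
    (fun n => iInter_subset _ n) ?_
  set K : ℝ≥0∞ := ENNReal.ofReal (u.map U).prod ^ (p : ℝ) with hK
  have hu0 : 0 ≤ (u.map U).prod := List.prod_nonneg (by simpa using fun i _ => hU0 i)
  have hbound : ∀ n, ∑' w, Metric.ediam (T u n w) ^ (p : ℝ) ≤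
      K * (∑' i : {i // i ∉ F}, g i) ^ n := by
    intro n
    rw [← ENNReal.tsum_pi_prod, ← ENNReal.tsum_mul_left]
    refine ENNReal.tsum_le_tsum fun w => ?_
    have hdiam : Metric.ediam (T u n w) ≤
        ENNReal.ofReal ((u.map U).prod * ∏ k, U (w k)) := by
      refine Metric.ediam_le ?_
      rintro _ ⟨x, hx, rfl⟩ _ ⟨y, hy, rfl⟩
      rw [edist_dist, Real.dist_eq]
      refine ENNReal.ofReal_le_ofReal ((abs_wordMap_sub_le hm hU0 hU _ hx hy).trans ?_)
      rw [List.map_append, List.prod_append, List.map_ofFn, List.prod_ofFn]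
      refine mul_le_of_le_one_right
        (mul_nonneg hu0 (Finset.prod_nonneg fun _ _ => hU0 _)) ?_
      rw [abs_le]
      constructor <;> linarith [hx.1, hx.2, hy.1, hy.2]
    refine (ENNReal.rpow_le_rpow hdiam hp'.le).trans_eq ?_
    rw [ENNReal.ofReal_mul hu0, ENNReal.mul_rpow_of_nonneg _ _ hp'.le,
      ENNReal.ofReal_prod_of_nonneg fun _ _ => hU0 _, ENNReal.prod_rpow_of_nonneg hp'.le]
  refine tendsto_of_tendsto_of_tendsto_of_le_of_le tendsto_const_nhds ?_ (fun _ => zero_le)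
    hbound
  have hK' : K ≠ ∞ := ENNReal.rpow_ne_top_of_nonneg hp'.le ENNReal.ofReal_ne_top
  simpa using ENNReal.Tendsto.const_mul (ENNReal.tendsto_pow_atTop_nhds_zero_of_lt_one hF)
    (Or.inr hK')

theorem growing_digits_strictMono {Φ : ℕ+ → ℝ} (hΦ : ∀ n : ℕ+, ((n : ℕ) : ℝ) ≤ Φ n) {a : ℕ → ℕ+}
    (ha : ∀ n, Φ (a n) < ((a (n + 1) : ℕ) : ℝ)) : StrictMono a :=
  strictMono_nat_of_lt_succ fun n => by
    exact_mod_cast (hΦ (a n)).trans_lt (ha n)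

theorem dimH_growingDigitSet_le {f : ℕ+ → ℝ → ℝ} {d : ℝ} (hf : IsDecayingIFS f d) {Φ : ℕ+ → ℝ}
    (hΦ : ∀ n : ℕ+, ((n : ℕ) : ℝ) ≤ Φ n) :
    dimH (growingDigitSet f Φ) ≤ ENNReal.ofReal (1 / d) := by
  have hd : 0 < d := zero_lt_one.trans hf.one_lt
  refine ENNReal.le_of_forall_pos_le_add fun η hη _ => ?_
  set p : ℝ≥0 := (1 / d).toNNReal + η with hpdef
  have hp : 0 < p := by positivity
  have hpd : 1 < p * d := by
    have : (p : ℝ) = 1 / d + η := by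
      rw [hpdef, NNReal.coe_add, Real.coe_toNNReal _ (by positivity)]
    rw [this, add_mul, one_div_mul_cancel hd.ne']
    have : (0 : ℝ) < η := hη
    nlinarith [mul_pos this hd]
  have hp' : (0 : ℝ) < p := hp
  -- an exponent `t < d` with `p * t > 1`
  obtain ⟨t, ht1, ht2⟩ : ∃ t : ℝ, 1 / p < t ∧ t < d :=
    exists_between ((div_lt_iff₀' hp').2 hpd)
  have ht : 1 < t * p := (div_lt_iff₀ hp').1 ht1
  obtain ⟨C, hC, hU⟩ := hf.exists_upper (sub_pos.2 ht2)
  rw [sub_sub_cancel] at hU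
  have hU0 : ∀ i : ℕ+, 0 ≤ C / ((i : ℕ) : ℝ) ^ t := fun i => by positivity
  have hsum : ∑' i : ℕ+, ENNReal.ofReal (C / ((i : ℕ) : ℝ) ^ t) ^ (p : ℝ) ≠ ∞ := by
    have hs : Summable fun i : ℕ+ => (C / ((i : ℕ) : ℝ) ^ t) ^ (p : ℝ) := by
      have := ((Real.summable_one_div_nat_rpow.2 ht).comp_injective
        PNat.coe_injective).mul_left (C ^ (p : ℝ))
      refine this.congr fun i => ?_
      rw [Real.div_rpow hC.le (by positivity), ← Real.rpow_mul (by positivity)]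
      simp [div_eq_mul_inv]
    rw [tsum_congr fun i => ENNReal.ofReal_rpow_of_nonneg (hU0 i) hp'.le]
    exact hs.tsum_ofReal_ne_top
  refine (dimH_mono ?_).trans ((dimH_injective_digits_le hf.mapsTo
    (fun i => (hf.contDiffOn i).continuousOn) hU0 hU hp hsum).trans ?_)
  · rintro x ⟨a, ha, hx⟩
    exact ⟨a, (growing_digits_strictMono hΦ ha).injective, hx⟩
  · rw [hpdef, ENNReal.coe_add]
    exact le_rfl

/-! ### Lower bound: mass distribution on a Cantor set -/

open MeasureTheory ProbabilityTheory

theorem infinitePi_uniformOn_cylinder (N : ℕ → ℕ) [∀ k, NeZero (N k)] (η : ∀ k, Fin (N k))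
    (n : ℕ) :
    Measure.infinitePi (fun k => uniformOn (univ : Set (Fin (N k)))) {ω | ∀ k < n, ω k = η k} =
      ∏ k ∈ Finset.range n, (N k : ℝ≥0∞)⁻¹ := by
  have : {ω : ∀ k, Fin (N k) | ∀ k < n, ω k = η k} =
      Set.pi (Finset.range n) fun k => {η k} := by
    ext ω
    simp
  rw [this, Measure.infinitePi_pi _ fun _ _ => measurableSet_singleton _]
  refine Finset.prod_congr rfl fun k _ => ?_
  simp [uniformOn_univ]

/-- The function telling whether the left endpoint `l` of an interval lies left of `[p, p + δ)`,
in it, or right of it. -/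
noncomputable def endpointClass (p δ l : ℝ) : Fin 3 :=
  if l < p then 0 else if l < p + δ then 1 else 2

/-- Closed intervals of length at least `δ` that meet `[p, p + δ]` have overlapping interiors when
their left endpoints have the same class. So at most three of them have disjoint interiors. -/
theorem inter_Ioo_nonempty_of_endpointClass_eq {p δ l r l' r' x x' : ℝ} (hδ : 0 < δ)
    (hlr : l + δ ≤ r) (hlr' : l' + δ ≤ r') (hx : x ∈ Icc l r) (hx' : x' ∈ Icc l' r')
    (hxp : x ∈ Icc p (p + δ)) (hxp' : x' ∈ Icc p (p + δ))
    (h : endpointClass p δ l = endpointClass p δ l') : (Ioo l r ∩ Ioo l' r').Nonempty := by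
  rw [Ioo_inter_Ioo, nonempty_Ioo, max_lt_iff, lt_min_iff, lt_min_iff]
  obtain ⟨h1, h2⟩ := hx
  obtain ⟨h3, h4⟩ := hx'
  obtain ⟨h5, h6⟩ := hxp
  obtain ⟨h7, h8⟩ := hxp'
  unfold endpointClass at h
  split_ifs at h <;> first | (exfalso; revert h; decide) | skip
  all_goals
    refine ⟨⟨?_, ?_⟩, ?_, ?_⟩ <;> linarith

theorem measurable_of_hasDigits {f : ℕ+ → ℝ → ℝ} {N : ℕ → ℕ} {e : ∀ k, Fin (N k) → ℕ+}
    {φ : (∀ k, Fin (N k)) → ℝ} (hφ : ∀ ω, HasDigits f (fun k => e k (ω k)) (φ ω)) :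
    Measurable φ := by
  refine measurable_of_tendsto_metrizable
    (f := fun n ω => wordMap f (List.ofFn fun k : Fin n => e k (ω k)) 1) (fun n => ?_)
    (tendsto_pi_nhds.2 fun ω => ?_)
  · exact (measurable_of_countable fun v : ∀ k : Fin n, Fin (N k) =>
      wordMap f (List.ofFn fun k : Fin n => e k (v k)) 1).comp
      (measurable_pi_lambda _ fun k => measurable_pi_apply _)
  · exact hφ ω

section Mass

variable {f : ℕ+ → ℝ → ℝ} {N : ℕ → ℕ} [∀ k, NeZero (N k)] {e : ∀ k, Fin (N k) → ℕ+}
  {φ : (∀ k, Fin (N k)) → ℝ}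

/-- If all cylinders of level `n` have length at least `δ`, then a set of diameter at most `δ`
meets at most three of them, so its mass under the uniform measure on digit sequences is at most
three times that of a cylinder. -/
theorem measure_preimage_le (hm : ∀ i, MapsTo (f i) (Icc 0 1) (Icc 0 1))
    (hc : ∀ i, ContinuousOn (f i) (Icc 0 1)) (hi : ∀ i, InjOn (f i) (Icc 0 1))
    (hd : ∀ i j, i ≠ j → f i '' Ioo 0 1 ∩ f j '' Ioo 0 1 = ∅)
    (he : ∀ k, (e k).Injective) (hφ : ∀ ω, HasDigits f (fun k => e k (ω k)) (φ ω)) {n : ℕ}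
    {δ : ℝ} (hδ : 0 < δ)
    (hlen : ∀ ω : ∀ k, Fin (N k), δ ≤ |wordMap f (List.ofFn fun k : Fin n => e k (ω k)) 0 -
      wordMap f (List.ofFn fun k : Fin n => e k (ω k)) 1|)
    {S : Set ℝ} (hS : ∀ x ∈ S, ∀ y ∈ S, |x - y| ≤ δ) :
    Measure.infinitePi (fun k => uniformOn (univ : Set (Fin (N k)))) (φ ⁻¹' S) ≤
      3 * ∏ k ∈ Finset.range n, (N k : ℝ≥0∞)⁻¹ := by
  set μ := Measure.infinitePi (fun k => uniformOn (univ : Set (Fin (N k))))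
  rcases S.eq_empty_or_nonempty with rfl | hne
  · simp
  obtain ⟨p, hp⟩ : ∃ p, S ⊆ Icc p (p + δ) := by
    obtain ⟨x₀, hx₀⟩ := hne
    have hbdd : BddBelow S := ⟨x₀ - δ, fun y hy => by
      linarith [(abs_le.1 (hS x₀ hx₀ y hy)).2]⟩
    refine ⟨sInf S, fun x hx => ⟨csInf_le hbdd hx, ?_⟩⟩
    have : x - δ ≤ sInf S := le_csInf ⟨x₀, hx₀⟩ fun y hy => by
      linarith [(abs_le.1 (hS x hx y hy)).2]
    linarith
  let g : (∀ k, Fin (N k)) → ℝ → ℝ := fun ω =>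
    wordMap f (List.ofFn fun k : Fin n => e k (ω k))
  have hg : ∀ ω, MapsTo (g ω) (Icc 0 1) (Icc (min (g ω 0) (g ω 1)) (max (g ω 0) (g ω 1))) ∧
      g ω '' Ioo 0 1 = Ioo (min (g ω 0) (g ω 1)) (max (g ω 0) (g ω 1)) := fun ω =>
    image_unitInterval (wordMap_continuousOn hm hc _) (wordMap_injOn hm hi _)
  have hmem : ∀ ω, φ ω ∈ Icc (min (g ω 0) (g ω 1)) (max (g ω 0) (g ω 1)) := fun ω => by
    obtain ⟨y, hy, hyx⟩ := (hφ ω).mem_image hm hc n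
    rw [← hyx]
    exact (hg ω).1 hy
  have hlr : ∀ ω, min (g ω 0) (g ω 1) + δ ≤ max (g ω 0) (g ω 1) := fun ω => by
    have := hlen ω
    rw [← max_sub_min_eq_abs'] at this
    linarith
  let c : (∀ k, Fin (N k)) → Fin 3 := fun ω => endpointClass p δ (min (g ω 0) (g ω 1))
  have hcyl : ∀ ω ∈ φ ⁻¹' S, ∀ η ∈ φ ⁻¹' S, c ω = c η → ∀ k < n, ω k = η k := by
    intro ω hω η hη h k hk
    obtain ⟨z, hz, hz'⟩ := inter_Ioo_nonempty_of_endpointClass_eq hδ (hlr ω) (hlr η) (hmem ω)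
      (hmem η) (hp hω) (hp hη) h
    rw [← (hg _).2] at hz hz'
    obtain ⟨x, hx, hxz⟩ := hz
    obtain ⟨y, hy, hyz⟩ := hz'
    have := eq_of_wordMap_eq hm hc hi hd (by simp) hx hy (hxz.trans hyz.symm)
    exact he k (congrFun (List.ofFn_injective this) ⟨k, hk⟩)
  have hclass : ∀ j : Fin 3, μ (φ ⁻¹' S ∩ c ⁻¹' {j}) ≤
      ∏ k ∈ Finset.range n, (N k : ℝ≥0∞)⁻¹ := by
    intro j
    rcases (φ ⁻¹' S ∩ c ⁻¹' {j}).eq_empty_or_nonempty with h | ⟨η, hη, hηj⟩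
    · simp [h]
    · rw [← infinitePi_uniformOn_cylinder N η n]
      exact measure_mono fun ω hω => hcyl ω hω.1 η hη (hω.2.trans hηj.symm)
  calc μ (φ ⁻¹' S) ≤ μ (⋃ j, φ ⁻¹' S ∩ c ⁻¹' {j}) :=
        measure_mono fun ω hω => mem_iUnion.2 ⟨c ω, hω, rfl⟩
    _ ≤ ∑ j, μ (φ ⁻¹' S ∩ c ⁻¹' {j}) := measure_iUnion_fintype_le _ _
    _ ≤ ∑ _j : Fin 3, ∏ k ∈ Finset.range n, (N k : ℝ≥0∞)⁻¹ :=
        Finset.sum_le_sum fun j _ => hclass j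
    _ = _ := by simp

/-- Mass distribution principle for the image of the uniform measure on digit sequences. The
cylinder lengths `δ (n + 1)` may be much smaller than `δ n`, so the mass of level `n` is compared
with the length of level `n + 1`. -/
theorem le_dimH_range (hm : ∀ i, MapsTo (f i) (Icc 0 1) (Icc 0 1))
    (hc : ∀ i, ContinuousOn (f i) (Icc 0 1)) (hi : ∀ i, InjOn (f i) (Icc 0 1))
    (hd : ∀ i j, i ≠ j → f i '' Ioo 0 1 ∩ f j '' Ioo 0 1 = ∅)
    (he : ∀ k, (e k).Injective) (hφ : ∀ ω, HasDigits f (fun k => e k (ω k)) (φ ω))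
    {δ : ℕ → ℝ} (hδ : ∀ n, 0 < δ n) (hδ0 : Tendsto δ atTop (𝓝 0))
    (hlen : ∀ n, ∀ ω : ∀ k, Fin (N k),
      δ n ≤ |wordMap f (List.ofFn fun k : Fin n => e k (ω k)) 0 -
        wordMap f (List.ofFn fun k : Fin n => e k (ω k)) 1|)
    {s : ℝ≥0} (hs : 0 < s)
    (hmass : ∀ᶠ n in atTop, 3 * ∏ k ∈ Finset.range n, (N k : ℝ)⁻¹ ≤ δ (n + 1) ^ (s : ℝ)) :
    s ≤ dimH (range φ) := by
  have hs' : (0 : ℝ) < s := hs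
  obtain ⟨n₀, hn₀⟩ := eventually_atTop.1 hmass
  set μ := Measure.infinitePi (fun k => uniformOn (univ : Set (Fin (N k))))
  have hφm := measurable_of_hasDigits hφ
  have hbound : ∀ n ≥ n₀, ∀ S : Set ℝ, Metric.ediam S ≤ ENNReal.ofReal (δ n) →
      μ.map φ S ≤ ENNReal.ofReal (δ (n + 1) ^ (s : ℝ)) := by
    intro n hn S hS
    calc μ.map φ S ≤ μ.map φ (closure S) := measure_mono subset_closure
      _ = μ (φ ⁻¹' closure S) := Measure.map_apply hφm isClosed_closure.measurableSet
      _ ≤ 3 * ∏ k ∈ Finset.range n, (N k : ℝ≥0∞)⁻¹ := by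
          refine measure_preimage_le hm hc hi hd he hφ (hδ n) (hlen n) fun x hx y hy => ?_
          have := (Metric.edist_le_ediam_of_mem hx hy).trans
            (Metric.ediam_closure S |>.le.trans hS)
          rwa [edist_dist, ENNReal.ofReal_le_ofReal_iff (hδ n).le, Real.dist_eq] at this
      _ = ENNReal.ofReal (3 * ∏ k ∈ Finset.range n, (N k : ℝ)⁻¹) := by
          rw [ENNReal.ofReal_mul (by norm_num), ENNReal.ofReal_prod_of_nonneg
            fun _ _ => by positivity]
          congr 1
          · simp
          · refine Finset.prod_congr rfl fun k _ => ?_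
            rw [ENNReal.ofReal_inv_of_pos (by exact_mod_cast NeZero.pos (N k)),
              ENNReal.ofReal_natCast]
      _ ≤ _ := ENNReal.ofReal_le_ofReal (hn₀ n hn)
  have hle : μ.map φ ≤ μH[(s : ℝ)] := by
    refine Measure.le_hausdorffMeasure _ _ (ENNReal.ofReal (δ n₀)) (by simpa using hδ n₀)
      fun S hS => ?_
    have htop : Metric.ediam S ≠ ∞ := ne_top_of_le_ne_top ENNReal.ofReal_ne_top hS
    rcases eq_or_ne (Metric.ediam S) 0 with h0 | h0
    · have hlim : Tendsto (fun n => ENNReal.ofReal (δ (n + 1) ^ (s : ℝ))) atTop (𝓝 0) := by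
        have := (((hδ0.comp (tendsto_add_atTop_nat 1)).rpow_const (p := (s : ℝ))
          (Or.inr hs'.le)))
        rw [Real.zero_rpow hs'.ne'] at this
        simpa using ENNReal.tendsto_ofReal this
      refine (ge_of_tendsto hlim ?_).trans zero_le
      filter_upwards [eventually_ge_atTop n₀] with n hn
      exact hbound n hn S (by simp [h0])
    · -- the level `n₀ + j` is the last one whose cylinders are guaranteed to be longer than `S`
      set r := (Metric.ediam S).toReal with hr
      have hSr : Metric.ediam S = ENNReal.ofReal r := (ENNReal.ofReal_toReal htop).symm
      have hr0 : 0 < r := ENNReal.toReal_pos h0 htop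
      have hex : ∃ j, δ (n₀ + j) < r := by
        have := (hδ0.comp (tendsto_add_atTop_nat n₀)).eventually_lt_const hr0
        obtain ⟨j, hj⟩ := this.exists
        exact ⟨j, by simpa [add_comm] using hj⟩
      classical
      have hspec := Nat.find_spec hex
      have hpos : Nat.find hex ≠ 0 := by
        intro h
        rw [h, add_zero] at hspec
        rw [hSr, ENNReal.ofReal_le_ofReal_iff (hδ n₀).le] at hS
        exact hspec.not_ge hS
      obtain ⟨j, hj⟩ := Nat.exists_eq_succ_of_ne_zero hpos
      have hmin : r ≤ δ (n₀ + j) := not_lt.1 (Nat.find_min hex (by omega))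
      rw [hj] at hspec
      rw [hSr, ENNReal.ofReal_rpow_of_pos hr0]
      refine (hbound (n₀ + j) (by omega) S (hSr.le.trans (ENNReal.ofReal_le_ofReal hmin))).trans
        (ENNReal.ofReal_le_ofReal (Real.rpow_le_rpow (hδ _).le hspec.le hs'.le))
  refine le_dimH_of_hausdorffMeasure_ne_zero (ne_of_gt ?_)
  calc (0 : ℝ≥0∞) < μ (φ ⁻¹' range φ) := by simp [μ]
    _ ≤ μ.map φ (range φ) := Measure.le_map_apply hφm.aemeasurable _
    _ ≤ _ := hle _

end Mass

theorem exists_hasDigits {f : ℕ+ → ℝ → ℝ} (hm : ∀ i, MapsTo (f i) (Icc 0 1) (Icc 0 1))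
    {U : ℕ+ → ℝ} (hU0 : ∀ i, 0 ≤ U i) (hU : ∀ i : ℕ+, ∀ x ∈ Icc (0 : ℝ) 1, ∀ y ∈ Icc (0 : ℝ) 1,
      |f i x - f i y| ≤ U i * |x - y|) {a : ℕ → ℕ+} (ha : ∀ k, U (a k) ≤ 1 / 2) :
    ∃ x, HasDigits f a x := by
  refine cauchySeq_tendsto_of_complete (cauchySeq_of_le_geometric (1 / 2) 1 (by norm_num)
    fun n => ?_)
  have h1 : (1 : ℝ) ∈ Icc (0 : ℝ) 1 := by simp
  rw [ofFn_add_eq_append a n 1, wordMap_append, Real.dist_eq]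
  set y := wordMap f (List.ofFn fun k : Fin 1 => a (n + k)) 1
  have hy : y ∈ Icc (0 : ℝ) 1 := wordMap_mapsTo hm _ h1
  refine (abs_wordMap_sub_le hm hU0 hU _ h1 hy).trans ?_
  rw [List.map_ofFn, List.prod_ofFn, mul_comm]
  refine mul_le_mul (by rw [abs_le]; constructor <;> linarith [hy.1, hy.2]) ?_
    (Finset.prod_nonneg fun _ _ => hU0 _) zero_le_one
  calc ∏ k : Fin n, U (a k) ≤ ∏ _k : Fin n, (1 / 2 : ℝ) :=
        Finset.prod_le_prod (fun _ _ => hU0 _) fun k _ => ha k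
    _ = (1 / 2) ^ n := by simp

/-- With `∏ M ^ (k+1)` cylinders of level `n`, of length at least `∏ c / (2 * M ^ (k+1)) ^ D`, the
mass of a cylinder is eventually smaller than the `s`-th power of the lengths of the next level,
as soon as `s * D < 1`. -/
theorem eventually_mass_le {M : ℕ} (hM : 2 ≤ M) {c D s : ℝ} (hc : 0 < c) (hs : D * s < 1) :
    ∀ᶠ n in atTop, 3 * ∏ k ∈ Finset.range n, (((M ^ (k + 1) : ℕ) : ℝ))⁻¹ ≤
      (∏ k ∈ Finset.range (n + 1), c / (2 * (M : ℝ) ^ (k + 1)) ^ D) ^ s := by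
  have hM0 : (0 : ℝ) < M := by positivity
  set P : ℕ → ℝ := fun n => ∏ k ∈ Finset.range n, (((M ^ (k + 1) : ℕ) : ℝ))⁻¹ with hP
  set δ : ℕ → ℝ := fun n => ∏ k ∈ Finset.range n, c / (2 * (M : ℝ) ^ (k + 1)) ^ D with hδ
  have hP0 : ∀ n, 0 < P n := fun n => Finset.prod_pos fun _ _ => by positivity
  have hδ0 : ∀ n, 0 < δ n := fun n => Finset.prod_pos fun _ _ => by positivity
  set h : ℕ → ℝ := fun n => 3 * P n / δ (n + 1) ^ s with hh
  have hh0 : ∀ n, 0 < h n := fun n =>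
    div_pos (mul_pos three_pos (hP0 n)) (Real.rpow_pos_of_pos (hδ0 _) _)
  have hratio : ∀ n, ‖h (n + 1)‖ / ‖h n‖ =
      (2 * (M : ℝ)) ^ (D * s) / c ^ s * ((M : ℝ) ^ (n + 1)) ^ (-(1 - D * s)) := by
    intro n
    have hy : (0 : ℝ) < (M : ℝ) ^ (n + 1) := by positivity
    have e1 : P (n + 1) = P n * ((M : ℝ) ^ (n + 1))⁻¹ := by
      simp [hP, Finset.prod_range_succ, mul_comm]
    have e2 : δ (n + 1 + 1) = δ (n + 1) * (c / (2 * (M : ℝ) * (M : ℝ) ^ (n + 1)) ^ D) := by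
      simp only [hδ]
      rw [Finset.prod_range_succ _ (n + 1), pow_succ' _ (n + 1), mul_assoc]
    rw [Real.norm_of_nonneg (hh0 _).le, Real.norm_of_nonneg (hh0 _).le]
    simp only [hh]
    rw [e1, e2, Real.mul_rpow (hδ0 _).le (by positivity), Real.div_rpow hc.le (by positivity),
      ← Real.rpow_mul (by positivity), Real.mul_rpow (by positivity) hy.le, neg_sub,
      Real.rpow_sub hy, Real.rpow_one]
    have := (hP0 n).ne'
    have := (Real.rpow_pos_of_pos (hδ0 (n + 1)) s).ne'
    have := (Real.rpow_pos_of_pos hc s).ne'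
    field_simp
  have hlim : Tendsto h atTop (𝓝 0) := by
    refine (summable_of_ratio_test_tendsto_lt_one zero_lt_one
      (Eventually.of_forall fun n => (hh0 n).ne') ?_).tendsto_atTop_zero
    simp only [hratio]
    have hpow : Tendsto (fun n : ℕ => (M : ℝ) ^ (n + 1)) atTop atTop :=
      (tendsto_pow_atTop_atTop_of_one_lt (by exact_mod_cast hM)).comp (tendsto_add_atTop_nat 1)
    simpa using ((tendsto_rpow_neg_atTop (sub_pos.2 hs)).comp hpow).const_mul
      ((2 * (M : ℝ)) ^ (D * s) / c ^ s)
  filter_upwards [hlim.eventually_lt_const zero_lt_one] with n hn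
  exact ((div_lt_one (Real.rpow_pos_of_pos (hδ0 _) _)).1 hn).le

theorem le_dimH_growingDigitSet {f : ℕ+ → ℝ → ℝ} {d : ℝ} (hf : IsDecayingIFS f d) {Φ : ℕ+ → ℝ}
    {β : ℝ} (hβ : 0 ≤ β) (hΦ : ∀ n : ℕ+, Φ n ≤ β * ((n : ℕ) : ℝ)) :
    ENNReal.ofReal (1 / d) ≤ dimH (growingDigitSet f Φ) := by
  have hd : 0 < d := zero_lt_one.trans hf.one_lt
  refine ENNReal.le_of_forall_nnreal_lt fun s hs => ?_
  rcases eq_or_ne s 0 with rfl | hs0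
  · simp
  have hs0 : 0 < s := pos_iff_ne_zero.2 hs0
  have hs0' : (0 : ℝ) < s := hs0
  -- an exponent `D > d` with `D * s < 1`
  obtain ⟨D, hdD, hDs⟩ : ∃ D : ℝ, d < D ∧ D * s < 1 := by
    have h1 : (s : ℝ) < 1 / d := by
      rwa [← ENNReal.ofReal_coe_nnreal, ENNReal.ofReal_lt_ofReal_iff (by positivity)] at hs
    obtain ⟨D, h2, h3⟩ := exists_between ((lt_div_iff₀ hs0').2 ((lt_div_iff₀' hd).1 h1))
    exact ⟨D, h2, (lt_div_iff₀ hs0').1 h3⟩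
  obtain ⟨C₁, hC₁, hL⟩ := hf.exists_lower (sub_pos.2 hdD)
  rw [add_sub_cancel] at hL
  -- with `ε = d - 1` the Lipschitz constants are `C₂ / i`, enough for convergence of the coding
  obtain ⟨C₂, hC₂, hU⟩ := hf.exists_upper (sub_pos.2 hf.one_lt)
  simp only [sub_sub_cancel, Real.rpow_one] at hU
  have hm := hf.mapsTo
  have hc : ∀ i, ContinuousOn (f i) (Icc 0 1) := fun i => (hf.contDiffOn i).continuousOn
  have hi : ∀ i, InjOn (f i) (Icc 0 1) := fun i x hx y hy hxy => by
    have h := hL i x hx y hy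
    rw [hxy, sub_self, abs_zero] at h
    have hpos : 0 < C₁ / ((i : ℕ) : ℝ) ^ D := by
      have : (0 : ℝ) < (i : ℕ) := by exact_mod_cast i.pos
      positivity
    exact sub_eq_zero.1 (abs_nonpos_iff.1 (nonpos_of_mul_nonpos_right h hpos))
  -- digits above `M` contract by `1 / 2`, and `Φ n ≤ M * n / 2`
  obtain ⟨M, hM⟩ := exists_nat_ge (max 2 (max (2 * β) (2 * C₂)))
  have hM2 : (2 : ℝ) ≤ M := (le_max_left _ _).trans hM
  have hMβ : 2 * β ≤ M := ((le_max_left _ _).trans (le_max_right _ _)).trans hM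
  have hMC : 2 * C₂ ≤ M := ((le_max_right _ _).trans (le_max_right _ _)).trans hM
  have hM2' : 2 ≤ M := by exact_mod_cast hM2
  have : NeZero M := ⟨by omega⟩
  let N : ℕ → ℕ := fun k => M ^ (k + 1)
  have hN : ∀ k, NeZero (N k) := fun k => inferInstanceAs (NeZero (M ^ (k + 1)))
  let e : ∀ k, Fin (N k) → ℕ+ := fun k j => ⟨M ^ (k + 1) + j + 1, by omega⟩
  have he : ∀ k, (e k).Injective := fun k i j hij => by
    have := congrArg PNat.val hij
    simp only [e, PNat.mk_coe] at this
    exact Fin.ext (by omega)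
  have hel : ∀ k j, (M : ℝ) ^ (k + 1) < ((e k j : ℕ) : ℝ) := fun k j => by
    have : M ^ (k + 1) < (e k j : ℕ) := by simp only [e, PNat.mk_coe]; omega
    exact_mod_cast this
  have heu : ∀ k j, ((e k j : ℕ) : ℝ) ≤ 2 * (M : ℝ) ^ (k + 1) := fun k j => by
    have : (e k j : ℕ) ≤ 2 * M ^ (k + 1) := by
      have hj : (j : ℕ) < M ^ (k + 1) := j.2
      simp only [e, PNat.mk_coe]; omega
    exact_mod_cast this
  have hdig : ∀ ω : ∀ k, Fin (N k), ∃ x, HasDigits f (fun k => e k (ω k)) x := fun ω => by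
    refine exists_hasDigits hm (fun i => by positivity) hU fun k => ?_
    have h1 : (M : ℝ) ≤ (M : ℝ) ^ (k + 1) := le_self_pow₀ (by linarith) (by omega)
    have h2 := hel k (ω k)
    rw [div_le_iff₀ (by linarith)]
    linarith
  choose φ hφ using hdig
  have hsub : range φ ⊆ growingDigitSet f Φ := by
    rintro _ ⟨ω, rfl⟩
    refine ⟨_, fun n => ?_, hφ ω⟩
    have hpos : (0 : ℝ) < M ^ (n + 1) := by positivity
    calc Φ (e n (ω n)) ≤ β * (2 * (M : ℝ) ^ (n + 1)) :=
          (hΦ _).trans (mul_le_mul_of_nonneg_left (heu n _) hβ)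
      _ = 2 * β * (M : ℝ) ^ (n + 1) := by ring
      _ ≤ M * (M : ℝ) ^ (n + 1) := mul_le_mul_of_nonneg_right hMβ hpos.le
      _ = (M : ℝ) ^ (n + 1 + 1) := (pow_succ' _ _).symm
      _ < _ := hel (n + 1) (ω (n + 1))
  refine le_trans ?_ (dimH_mono hsub)
  -- `c ≤ 1` makes the lower bounds for the lengths of the cylinders tend to `0`
  set c := min C₁ 1 with hcdef
  have hc0 : 0 < c := lt_min hC₁ one_pos
  have hD1 : 1 ≤ D := (hf.one_lt.trans hdD).le
  have hfac : ∀ k : ℕ, c / (2 * (M : ℝ) ^ (k + 1)) ^ D ≤ 1 / 2 := fun k => by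
    have h1 : (1 : ℝ) ≤ (M : ℝ) ^ (k + 1) := one_le_pow₀ (by linarith)
    have h2 : 2 * (M : ℝ) ^ (k + 1) ≤ (2 * (M : ℝ) ^ (k + 1)) ^ D :=
      Real.self_le_rpow_of_one_le (by linarith) hD1
    exact div_le_div₀ zero_le_one (min_le_right _ _) two_pos (by linarith)
  refine le_dimH_range (δ := fun n => ∏ k ∈ Finset.range n, c / (2 * (M : ℝ) ^ (k + 1)) ^ D)
    hm hc hi hf.disjoint he hφ (fun n => Finset.prod_pos fun _ _ => by positivity) ?_ ?_ hs0
    (eventually_mass_le hM2' hc0 hDs)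
  · refine squeeze_zero (fun n => Finset.prod_nonneg fun _ _ => by positivity) (fun n => ?_)
      (tendsto_pow_atTop_nhds_zero_of_lt_one (r := (1 / 2 : ℝ)) (by norm_num) (by norm_num))
    refine (Finset.prod_le_prod (fun _ _ => by positivity) fun k _ => hfac k).trans_eq ?_
    simp
  · intro n ω
    have := le_abs_wordMap_sub hm (fun i => by positivity) hL
      (List.ofFn fun k : Fin n => e k (ω k)) (x := 0) (y := 1) (by simp) (by simp)
    rw [zero_sub, abs_neg, abs_one, mul_one, List.map_ofFn, List.prod_ofFn] at this
    refine le_trans ?_ this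
    rw [Finset.prod_range]
    refine Finset.prod_le_prod (fun _ _ => by positivity) fun k _ => ?_
    have hpos : (0 : ℝ) < ((e k (ω k) : ℕ) : ℝ) := by exact_mod_cast (e k (ω k)).pos
    exact div_le_div₀ hC₁.le (min_le_left _ _) (Real.rpow_pos_of_pos hpos _)
      (Real.rpow_le_rpow hpos.le (heu k _) (by linarith))

theorem theorem1 (f : ℕ+ → ℝ → ℝ) (d : ℝ) (hf : IsDecayingIFS f d)
    (Φ : ℕ+ → ℝ) (β : ℝ) (hβ : 1 ≤ β)
    (hΦ : ∀ n : ℕ+, ((n : ℕ) : ℝ) ≤ Φ n ∧ Φ n ≤ β * ((n : ℕ) : ℝ)) :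
    dimH (growingDigitSet f Φ) = ENNReal.ofReal (1 / d) :=
  le_antisymm (dimH_growingDigitSet_le hf fun n => (hΦ n).1)
    (le_dimH_growingDigitSet hf (zero_le_one.trans hβ) fun n => (hΦ n).2)
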